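/- Let $d \ge 2$ be an integer. Let $\Phi_d$ be the cumulative distribution function of the chi-squared distribution with $d$ degrees of freedom, $\Psi_d(r) = 1 - \Phi_d(r^2)$ for $r \ge 0$ and $\Psi_d(r) = 1$ for $r < 0$, and $\Delta\Psi_d(R_1,R_2) = \Psi_d(R_1) - \Psi_d(R_2)$. Let $I_x(a,b) = \frac{1}{B(a,b)}\int_0^x t^{a-1}(1-t)^{b-1}\,dt$ be the regularized incomplete Euler beta function, where $B$ is the Euler beta function, and put $\mathcal{I}(x) = I_{1-x^2}\left(\frac{d-1}{2},\frac12\right)$, so that $\mathcal{I}(\cos\theta) = I_{\sin^2\theta}\left(\frac{d-1}{2},\frac12\right)$. For $R \ge 0$, $v \in \mathbb{R}^d\setminus\{0\}$ and $\theta\in[0,\pi/2]$, let $$S(0,R,v,\theta) = \{x \in \mathbb{R}^d : \|x\|_2 \le R,\ \langle x, v\rangle \ge \|x\|_2\,\|v\|_2\cos\theta\}$$ be the spherical sector of the ball of center $0$ and radius $R$ with axis $v$ and angle $\theta$ (measured from the axis), and let $\Delta S(0,R_2,R_1,v,\theta) = S(0,R_2,v,\theta)\smallsetminus S(0,R_1,v,\theta)$.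 Lemma (probability of a spherical-sector shell). Let $z \sim \mathcal{N}(0, I_d)$, $0 \le R_1 \le R_2$, $v \in \mathbb{R}^d\setminus\{0\}$ and $\theta \in [0,\pi/2]$. Then $$\mathbb{P}\left(z \in \Delta S(0,R_2,R_1,v,\theta)\right) = \frac{\mathcal{I}(\cos\theta)}{2}\,\Delta\Psi_d(R_1,R_2).$$ -/

import Mathlib

open MeasureTheory ProbabilityTheory

namespace SphericalSector

/-- The cumulative distribution function `Φ_d` of the chi-squared distribution with `d` degrees
of freedom, that is, of the Gamma distribution of shape `d / 2` and rate `1 / 2`. -/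
noncomputable def chiSqCDF (d : ℕ) (x : ℝ) : ℝ :=
  cdf (gammaMeasure ((d : ℝ) / 2) (1 / 2)) x

/-- `Ψ_d(r) = 1 - Φ_d(r²)` for `r ≥ 0`, and `Ψ_d(r) = 1` for `r < 0`. -/
noncomputable def Psi (d : ℕ) (r : ℝ) : ℝ :=
  if 0 ≤ r then 1 - chiSqCDF d (r ^ 2) else 1

/-- `ΔΨ_d(R₁, R₂) = Ψ_d(R₁) - Ψ_d(R₂)`. -/
noncomputable def deltaPsi (d : ℕ) (R₁ R₂ : ℝ) : ℝ :=
  Psi d R₁ - Psi d R₂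

/-- The regularized incomplete Euler beta function `I_x(a, b)`. -/
noncomputable def regIncBeta (x a b : ℝ) : ℝ :=
  1 / ProbabilityTheory.beta a b * ∫ t in (0 : ℝ)..x, t ^ (a - 1) * (1 - t) ^ (b - 1)

/-- `ℐ(x) = I_{1 - x²}((d - 1) / 2, 1 / 2)`; thus `ℐ(cos θ) = I_{sin² θ}((d - 1) / 2, 1 / 2)`. -/
noncomputable def sectorI (d : ℕ) (x : ℝ) : ℝ :=
  regIncBeta (1 - x ^ 2) (((d : ℝ) - 1) / 2) (1 / 2)

/-- The spherical sector of the closed ball of center `c` and radius `R`, with axis `v` and angle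
`θ`: the points `x` of the ball such that `x - c` makes an angle at most `θ` with `v`
(the apex `c` included), written as `‖x - c‖ ‖v‖ cos θ ≤ ⟪x - c, v⟫`. -/
def sector {d : ℕ} (c : EuclideanSpace ℝ (Fin d)) (R : ℝ) (v : EuclideanSpace ℝ (Fin d))
    (θ : ℝ) : Set (EuclideanSpace ℝ (Fin d)) :=
  {x | x ∈ Metric.closedBall c R ∧ ‖x - c‖ * ‖v‖ * Real.cos θ ≤ inner ℝ (x - c) v}

/-- The inequality in `sector` is the condition on the angle. -/
theorem mem_sector_iff_angle {d : ℕ} {c v x : EuclideanSpace ℝ (Fin d)} {R θ : ℝ}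
    (hv : v ≠ 0) (hx : x ≠ c) (h0 : 0 ≤ θ) (hpi : θ ≤ Real.pi) :
    x ∈ sector c R v θ ↔
      x ∈ Metric.closedBall c R ∧ InnerProductGeometry.angle (x - c) v ≤ θ := by
  have h1 : 0 < ‖x - c‖ * ‖v‖ :=
    mul_pos (norm_pos_iff.2 (sub_ne_zero.2 hx)) (norm_pos_iff.2 hv)
  unfold sector
  simp only [Set.mem_ofPred_eq]
  refine and_congr_right fun _ => ?_
  rw [← InnerProductGeometry.cos_angle_mul_norm_mul_norm (x - c) v, mul_comm _ (Real.cos θ),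
    mul_le_mul_iff_left₀ h1]
  exact Real.strictAntiOn_cos.le_iff_ge ⟨h0, hpi⟩
    ⟨InnerProductGeometry.angle_nonneg _ _, InnerProductGeometry.angle_le_pi _ _⟩

/-- The sector shell `ΔS(c, R₂, R₁, v, θ) = S(c, R₂, v, θ) \ S(c, R₁, v, θ)`. -/
def sectorShell {d : ℕ} (c : EuclideanSpace ℝ (Fin d)) (R₂ R₁ : ℝ)
    (v : EuclideanSpace ℝ (Fin d)) (θ : ℝ) : Set (EuclideanSpace ℝ (Fin d)) :=
  sector c R₂ v θ \ sector c R₁ v θ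

end SphericalSector

/-!
For a standard Gaussian vector `x` and a fixed axis `v`, the variables `‖x‖²` and `sin² ∠(x, v)` are
independent, with laws Gamma `(d / 2, 1 / 2)` and Beta `((d - 1) / 2, 1 / 2)`. Indeed, in an
orthonormal basis containing the direction of `v`, write `‖x‖² = X + Y` where `Y` is the square of
the coordinate along `v` and `X` is the sum of the other squares. Then `sin² ∠(x, v) = X / (X + Y)`,
and `X`, `Y` are independent with Gamma laws of shapes `(d - 1) / 2` and `1 / 2` and the same rate,
so that the beta-gamma identity applies.

The variable `sin² ∠(x, v)` does not distinguish `x` from `-x`: for `θ ≤ π / 2` the condition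
`sin² ∠(x, v) ≤ sin² θ` describes the double cone. A sector shell and its opposite cover the
corresponding shell of the double cone and meet in a subset of the hyperplane orthogonal to `v`,
which is null, so by invariance under `x ↦ -x` each carries half of the mass.
-/

namespace SphericalSector

open InnerProductGeometry Module Set
open scoped ENNReal NNReal

section ChangeOfVariables

lemma lintegral_eq_abs_mul_lintegral_comp_mul_left {s : ℝ} (hs : s ≠ 0) (f : ℝ → ℝ≥0∞) :
    ∫⁻ x, f x = ENNReal.ofReal |s| * ∫⁻ t, f (s * t) := by
  conv_lhs => rw [← Real.smul_map_volume_mul_left hs]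
  rw [lintegral_smul_measure, smul_eq_mul]
  congr 1
  exact lintegral_map_equiv f (Homeomorph.mulLeft₀ s hs).toMeasurableEquiv

lemma lintegral_eq_two_mul_setLIntegral_Ioi_of_even {f : ℝ → ℝ≥0∞} (hf : Function.Even f) :
    ∫⁻ x, f x = 2 * ∫⁻ x in Ioi 0, f x := by
  have h_neg : ∫⁻ x in Iic 0, f x = ∫⁻ x in Ioi 0, f x := by
    have h := (Measure.measurePreserving_neg (volume : Measure ℝ)).setLIntegral_comp_preimage_emb
      (MeasurableEquiv.neg ℝ).measurableEmbedding f (Iio 0)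
    simp only [hf _, neg_preimage, neg_Iio, neg_zero] at h
    rw [setLIntegral_congr Iio_ae_eq_Iic.symm, h]
  rw [← lintegral_add_compl f measurableSet_Ioi, compl_Ioi, h_neg, two_mul]

lemma image_sq_Ioi_zero : (fun x : ℝ ↦ x ^ 2) '' Ioi 0 = Ioi 0 := by
  ext y
  refine ⟨?_, fun hy ↦ ⟨√y, Real.sqrt_pos.2 hy, Real.sq_sqrt (le_of_lt hy)⟩⟩
  rintro ⟨x, hx, rfl⟩
  exact pow_pos (mem_Ioi.1 hx) 2

lemma setLIntegral_Ioi_zero_eq_comp_sq (f : ℝ → ℝ≥0∞) :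
    ∫⁻ y in Ioi 0, f y = ∫⁻ x in Ioi 0, ENNReal.ofReal (2 * x) * f (x ^ 2) := by
  have h_mono : MonotoneOn (fun x : ℝ ↦ x ^ 2) (Ioi 0) := fun x hx y _ hxy ↦
    pow_le_pow_left₀ (le_of_lt hx) hxy 2
  conv_lhs => rw [← image_sq_Ioi_zero]
  rw [lintegral_image_eq_lintegral_deriv_mul_of_monotoneOn measurableSet_Ioi
    (fun x _ ↦ (hasDerivAt_pow 2 x).hasDerivWithinAt) h_mono]
  simp

end ChangeOfVariables

section Densities

@[fun_prop]
lemma measurable_gammaPDF (a r : ℝ) : Measurable (gammaPDF a r) :=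
  (measurable_gammaPDFReal a r).ennreal_ofReal

@[fun_prop]
lemma measurable_betaPDF (a b : ℝ) : Measurable (betaPDF a b) :=
  (measurable_betaPDFReal a b).ennreal_ofReal

lemma lintegral_gammaMeasure (a r : ℝ) (f : ℝ → ℝ≥0∞) :
    ∫⁻ x, f x ∂gammaMeasure a r = ∫⁻ x, gammaPDF a r x * f x :=
  lintegral_withDensity_eq_lintegral_mul_non_measurable _ (measurable_gammaPDF a r)
    (ae_of_all _ fun _ ↦ ENNReal.ofReal_lt_top) f

lemma lintegral_betaMeasure (a b : ℝ) (f : ℝ → ℝ≥0∞) :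
    ∫⁻ x, f x ∂betaMeasure a b = ∫⁻ x, betaPDF a b x * f x :=
  lintegral_withDensity_eq_lintegral_mul_non_measurable _ (measurable_betaPDF a b)
    (ae_of_all _ fun _ ↦ ENNReal.ofReal_lt_top) f

lemma lintegral_gaussianReal (m : ℝ) {v : ℝ≥0} (hv : v ≠ 0) (f : ℝ → ℝ≥0∞) :
    ∫⁻ x, f x ∂gaussianReal m v = ∫⁻ x, gaussianPDF m v x * f x := by
  rw [gaussianReal_of_var_ne_zero m hv]
  exact lintegral_withDensity_eq_lintegral_mul_non_measurable _ (measurable_gaussianPDF m v)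
    (ae_of_all _ fun _ ↦ gaussianPDF_lt_top) f

lemma lintegral_gammaMeasure_eq_setLIntegral (a r : ℝ) (f : ℝ → ℝ≥0∞) :
    ∫⁻ x, f x ∂gammaMeasure a r = ∫⁻ x in Ioi 0, gammaPDF a r x * f x := by
  have h_neg : ∫⁻ x in Iic 0, gammaPDF a r x * f x = 0 := by
    rw [setLIntegral_congr Iio_ae_eq_Iic.symm]
    exact setLIntegral_eq_zero measurableSet_Iio fun x hx ↦ by
      rw [gammaPDF_of_neg hx, zero_mul, Pi.zero_apply]
  rw [lintegral_gammaMeasure, ← lintegral_add_compl _ measurableSet_Ioi, compl_Ioi, h_neg, add_zero]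

end Densities

section GammaBeta

variable {a b r : ℝ}

lemma gammaPDF_mul_gammaPDF {s t : ℝ} (ha : 0 < a) (hb : 0 < b) (hr : 0 < r) (hs : 0 < s)
    (ht₀ : 0 < t) (ht₁ : t < 1) :
    ENNReal.ofReal s * (gammaPDF a r (s * t) * gammaPDF b r (s * (1 - t))) =
      gammaPDF (a + b) r s * betaPDF a b t := by
  have ht₁' : 0 < 1 - t := sub_pos.2 ht₁
  have h_exp : Real.exp (-(r * (s * t))) * Real.exp (-(r * (s * (1 - t)))) =
      Real.exp (-(r * s)) := by
    rw [← Real.exp_add]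
    ring_nf
  have h_pow : s ^ (a + b - 1) = s * (s ^ (a - 1) * s ^ (b - 1)) := by
    rw [← Real.rpow_add hs, mul_comm, ← Real.rpow_add_one hs.ne']
    ring_nf
  rw [gammaPDF_of_nonneg (by positivity), gammaPDF_of_nonneg (by positivity),
    gammaPDF_of_nonneg hs.le, betaPDF_of_pos_lt_one ht₀ ht₁,
    ← ENNReal.ofReal_mul (by positivity), ← ENNReal.ofReal_mul hs.le,
    ← ENNReal.ofReal_mul (by positivity), Real.mul_rpow hs.le ht₀.le,
    Real.mul_rpow hs.le ht₁'.le, h_pow, ← h_exp, Real.rpow_add hr, ProbabilityTheory.beta]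
  field_simp

lemma ofReal_mul_gammaPDF_mul_gammaPDF_sub {s t : ℝ} (ha : 0 < a) (hb : 0 < b) (hr : 0 < r)
    (hs : 0 < s) (ht₀ : t ≠ 0) (ht₁ : t ≠ 1) :
    ENNReal.ofReal s * (gammaPDF a r (s * t) * gammaPDF b r (s - s * t)) =
      gammaPDF (a + b) r s * betaPDF a b t := by
  rw [show s - s * t = s * (1 - t) by ring]
  rcases ht₀.lt_or_gt with ht | ht₀
  · simp [gammaPDF_of_neg (mul_neg_of_pos_of_neg hs ht), betaPDF_eq_zero_of_nonpos ht.le]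
  rcases ht₁.lt_or_gt with ht₁ | ht
  · exact gammaPDF_mul_gammaPDF ha hb hr hs ht₀ ht₁
  · simp [gammaPDF_of_neg (mul_neg_of_pos_of_neg hs (sub_neg.2 ht)),
      betaPDF_eq_zero_of_one_le ht.le]

lemma gammaPDF_mul_gammaPDF_sub_of_neg {s : ℝ} (hs : s < 0) (x : ℝ) :
    gammaPDF a r x * gammaPDF b r (s - x) = 0 := by
  rcases lt_or_ge x 0 with hx | hx
  · rw [gammaPDF_of_neg hx, zero_mul]
  · rw [gammaPDF_of_neg (by linarith : s - x < 0), mul_zero]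

lemma lintegral_gammaPDF_mul_gammaPDF_sub (ha : 0 < a) (hb : 0 < b) (hr : 0 < r) {s : ℝ}
    (hs : s ≠ 0) (f : ℝ → ℝ≥0∞) :
    ∫⁻ x, gammaPDF a r x * gammaPDF b r (s - x) * f (x / s) =
      gammaPDF (a + b) r s * ∫⁻ t, f t ∂betaMeasure a b := by
  rcases hs.lt_or_gt with hs | hs
  · simp [gammaPDF_mul_gammaPDF_sub_of_neg hs, gammaPDF_of_neg hs]
  rw [lintegral_eq_abs_mul_lintegral_comp_mul_left hs.ne', abs_of_pos hs, lintegral_betaMeasure,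
    ← lintegral_const_mul' _ _ ENNReal.ofReal_ne_top,
    ← lintegral_const_mul' (gammaPDF (a + b) r s) _ ENNReal.ofReal_ne_top]
  refine lintegral_congr_ae ?_
  filter_upwards [Measure.ae_ne volume (0 : ℝ), Measure.ae_ne volume (1 : ℝ)] with t ht₀ ht₁
  rw [mul_div_cancel_left₀ _ hs.ne', ← mul_assoc,
    ofReal_mul_gammaPDF_mul_gammaPDF_sub ha hb hr hs ht₀ ht₁, mul_assoc]

theorem map_prod_gammaMeasure (ha : 0 < a) (hb : 0 < b) (hr : 0 < r) :
    ((gammaMeasure a r).prod (gammaMeasure b r)).map (fun p ↦ (p.1 + p.2, p.1 / (p.1 + p.2))) =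
      (gammaMeasure (a + b) r).prod (betaMeasure a b) := by
  have := isProbabilityMeasure_gammaMeasure hb hr
  have := isProbabilityMeasureBeta ha hb
  refine Measure.ext_of_lintegral _ fun f hf ↦ ?_
  calc ∫⁻ p, f p ∂((gammaMeasure a r).prod (gammaMeasure b r)).map _
      = ∫⁻ x, ∫⁻ y, f (x + y, x / (x + y)) ∂gammaMeasure b r ∂gammaMeasure a r := by
        rw [lintegral_map hf (by fun_prop), lintegral_prod _ (by fun_prop)]
    _ = ∫⁻ x, ∫⁻ s, gammaPDF a r x * gammaPDF b r (s - x) * f (s, x / s) := by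
        simp only [lintegral_gammaMeasure]
        refine lintegral_congr fun x ↦ ?_
        rw [← lintegral_sub_right_eq_self _ x,
          ← lintegral_const_mul' (gammaPDF a r x) _ ENNReal.ofReal_ne_top]
        simp only [add_sub_cancel, mul_assoc]
    _ = ∫⁻ s, ∫⁻ x, gammaPDF a r x * gammaPDF b r (s - x) * f (s, x / s) :=
        lintegral_lintegral_swap (by fun_prop)
    _ = ∫⁻ s, gammaPDF (a + b) r s * ∫⁻ t, f (s, t) ∂betaMeasure a b := by
        refine lintegral_congr_ae ?_
        filter_upwards [Measure.ae_ne volume (0 : ℝ)] with s hs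
        exact lintegral_gammaPDF_mul_gammaPDF_sub ha hb hr hs fun t ↦ f (s, t)
    _ = ∫⁻ p, f p ∂(gammaMeasure (a + b) r).prod (betaMeasure a b) := by
        rw [lintegral_prod _ hf.aemeasurable, lintegral_gammaMeasure]

variable {Ω : Type*} {mΩ : MeasurableSpace Ω} {P : Measure Ω} {X Y : Ω → ℝ}

theorem hasLaw_add_div_add_of_indepFun (ha : 0 < a) (hb : 0 < b) (hr : 0 < r)
    (hX : HasLaw X (gammaMeasure a r) P) (hY : HasLaw Y (gammaMeasure b r) P)
    (hXY : X ⟂ᵢ[P] Y) :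
    HasLaw (fun ω ↦ (X ω + Y ω, X ω / (X ω + Y ω)))
      ((gammaMeasure (a + b) r).prod (betaMeasure a b)) P := by
  have := isProbabilityMeasure_gammaMeasure ha hr
  have := hX.isProbabilityMeasure
  have h : HasLaw (fun p : ℝ × ℝ ↦ (p.1 + p.2, p.1 / (p.1 + p.2)))
      ((gammaMeasure (a + b) r).prod (betaMeasure a b))
      ((gammaMeasure a r).prod (gammaMeasure b r)) :=
    ⟨by fun_prop, map_prod_gammaMeasure ha hb hr⟩
  exact h.fun_comp ((indepFun_iff_hasLaw_prodMk_prod hX hY).1 hXY)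

lemma hasLaw_add_of_indepFun_gammaMeasure (ha : 0 < a) (hb : 0 < b) (hr : 0 < r)
    (hX : HasLaw X (gammaMeasure a r) P) (hY : HasLaw Y (gammaMeasure b r) P)
    (hXY : X ⟂ᵢ[P] Y) :
    HasLaw (fun ω ↦ X ω + Y ω) (gammaMeasure (a + b) r) P := by
  have := isProbabilityMeasureBeta ha hb
  exact measurePreserving_fst.fun_comp_hasLaw (hasLaw_add_div_add_of_indepFun ha hb hr hX hY hXY)

theorem hasLaw_sum_of_iIndepFun_gammaMeasure {ι : Type*} {s : Finset ι} (hs : s.Nonempty)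
    {a : ι → ℝ} (ha : ∀ i, 0 < a i) (hr : 0 < r) {X : ι → Ω → ℝ}
    (hX : ∀ i, HasLaw (X i) (gammaMeasure (a i) r) P) (hX_indep : iIndepFun X P) :
    HasLaw (∑ i ∈ s, X i) (gammaMeasure (∑ i ∈ s, a i) r) P := by
  induction hs using Finset.Nonempty.cons_induction with
  | singleton i => simpa only [Finset.sum_singleton] using hX i
  | cons i s hi hs ih =>
    rw [Finset.sum_cons, Finset.sum_cons]
    exact hasLaw_add_of_indepFun_gammaMeasure (ha i) (Finset.sum_pos (fun j _ ↦ ha j) hs) hr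
      (hX i) ih (hX_indep.indepFun_finsetSum_of_notMem₀ (fun j ↦ (hX j).aemeasurable) hi).symm

end GammaBeta

section ChiSquared

variable {v : ℝ≥0}

lemma two_mul_gaussianPDF_eq (hv : v ≠ 0) {x : ℝ} (hx : 0 < x) :
    2 * gaussianPDF 0 v x =
      ENNReal.ofReal (2 * x) * gammaPDF (1 / 2) (1 / (2 * v)) (x ^ 2) := by
  have : (0 : ℝ) < v := NNReal.coe_pos.2 (pos_iff_ne_zero.2 hv)
  have h_inv : (x ^ 2) ^ (1 / 2 - 1 : ℝ) = x⁻¹ := by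
    rw [← Real.rpow_natCast_mul hx.le, ← Real.rpow_neg_one]
    norm_num
  rw [gaussianPDF, gammaPDF_of_nonneg (sq_nonneg x), ← ENNReal.ofReal_ofNat 2,
    ← ENNReal.ofReal_mul zero_le_two, ← ENNReal.ofReal_mul (by positivity), h_inv,
    gaussianPDFReal, Real.Gamma_one_half_eq, ← Real.sqrt_eq_rpow, Real.sqrt_div zero_le_one,
    Real.sqrt_one, sub_zero, mul_right_comm 2 Real.pi, Real.sqrt_mul (by positivity) Real.pi]
  field_simp

theorem map_sq_gaussianReal (hv : v ≠ 0) :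
    (gaussianReal 0 v).map (fun x ↦ x ^ 2) = gammaMeasure (1 / 2) (1 / (2 * v)) := by
  refine Measure.ext_of_lintegral _ fun f hf ↦ ?_
  have h_even : Function.Even fun x ↦ gaussianPDF 0 v x * f (x ^ 2) := fun x ↦ by
    simp only [gaussianPDF, gaussianPDFReal, sub_zero, neg_sq]
  rw [lintegral_map hf (by fun_prop), lintegral_gaussianReal 0 hv,
    lintegral_eq_two_mul_setLIntegral_Ioi_of_even h_even,
    lintegral_gammaMeasure_eq_setLIntegral,
    setLIntegral_Ioi_zero_eq_comp_sq fun y ↦ gammaPDF (1 / 2) (1 / (2 * v)) y * f y,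
    ← lintegral_const_mul' _ _ ENNReal.ofNat_ne_top]
  refine setLIntegral_congr_fun measurableSet_Ioi fun x hx ↦ ?_
  rw [← mul_assoc, ← mul_assoc, two_mul_gaussianPDF_eq hv hx]

variable {Ω : Type*} {mΩ : MeasurableSpace Ω} {P : Measure Ω}

theorem hasLaw_sum_sq_of_iIndepFun_gaussianReal {ι : Type*} {s : Finset ι} (hs : s.Nonempty)
    {X : ι → Ω → ℝ} (hv : v ≠ 0) (hX : ∀ i, HasLaw (X i) (gaussianReal 0 v) P)
    (hX_indep : iIndepFun X P) :
    HasLaw (fun ω ↦ ∑ i ∈ s, X i ω ^ 2) (gammaMeasure (s.card / 2) (1 / (2 * v))) P := by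
  have h_sq : HasLaw (fun x : ℝ ↦ x ^ 2) (gammaMeasure (1 / 2) (1 / (2 * v)))
      (gaussianReal 0 v) := ⟨by fun_prop, map_sq_gaussianReal hv⟩
  have : (0 : ℝ) < v := NNReal.coe_pos.2 (pos_iff_ne_zero.2 hv)
  have h := hasLaw_sum_of_iIndepFun_gammaMeasure hs (fun _ ↦ one_half_pos) (by positivity)
    (fun i ↦ h_sq.fun_comp (hX i)) (hX_indep.comp (fun _ x ↦ x ^ 2) fun _ ↦ by fun_prop)
  rwa [Finset.sum_const, nsmul_eq_mul, mul_one_div, Finset.sum_fn] at h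

theorem hasLaw_sum_sq_div_of_iIndepFun_gaussianReal {ι : Type*} {s t : Finset ι}
    (hs : s.Nonempty) (ht : t.Nonempty) (hst : Disjoint s t) {X : ι → Ω → ℝ} (hv : v ≠ 0)
    (hX : ∀ i, HasLaw (X i) (gaussianReal 0 v) P) (hX_indep : iIndepFun X P) :
    HasLaw (fun ω ↦ (∑ i ∈ s, X i ω ^ 2 + ∑ i ∈ t, X i ω ^ 2,
        (∑ i ∈ s, X i ω ^ 2) / (∑ i ∈ s, X i ω ^ 2 + ∑ i ∈ t, X i ω ^ 2)))
      ((gammaMeasure (s.card / 2 + t.card / 2) (1 / (2 * v))).prod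
        (betaMeasure (s.card / 2) (t.card / 2))) P := by
  have : (0 : ℝ) < s.card := by exact_mod_cast hs.card_pos
  have : (0 : ℝ) < t.card := by exact_mod_cast ht.card_pos
  have : (0 : ℝ) < v := NNReal.coe_pos.2 (pos_iff_ne_zero.2 hv)
  have h_indep : (fun ω ↦ ∑ i ∈ s, X i ω ^ 2) ⟂ᵢ[P] (fun ω ↦ ∑ i ∈ t, X i ω ^ 2) := by
    have h := (hX_indep.indepFun_finset₀ s t hst fun i ↦ (hX i).aemeasurable).comp
      (φ := fun x ↦ ∑ i, x i ^ 2) (ψ := fun x ↦ ∑ i, x i ^ 2) (by fun_prop) (by fun_prop)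
    simpa only [Function.comp_def, ← Finset.sum_coe_sort s, ← Finset.sum_coe_sort t] using h
  exact hasLaw_add_div_add_of_indepFun (by positivity) (by positivity) (by positivity)
    (hasLaw_sum_sq_of_iIndepFun_gaussianReal hs hv hX hX_indep)
    (hasLaw_sum_sq_of_iIndepFun_gaussianReal ht hv hX hX_indep) h_indep

end ChiSquared

section StdGaussian

variable {E : Type*} [NormedAddCommGroup E] [InnerProductSpace ℝ E]

lemma sin_angle_sq_eq_div {e x : E} (he : ‖e‖ = 1) (hx : x ≠ 0) :
    Real.sin (angle x e) ^ 2 = (‖x‖ ^ 2 - inner ℝ e x ^ 2) / ‖x‖ ^ 2 := by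
  have hx' : ‖x‖ ≠ 0 := norm_ne_zero_iff.2 hx
  rw [Real.sin_sq, cos_angle, he, mul_one, real_inner_comm, div_pow]
  field_simp

variable [FiniteDimensional ℝ E]

lemma exists_orthonormalBasis_apply_eq {e : E} (he : ‖e‖ = 1) :
    ∃ (s : Finset E) (b : OrthonormalBasis s ℝ E) (i : s), b i = e := by
  have h_orthonormal : Orthonormal ℝ ((↑) : ({e} : Set E) → E) :=
    ⟨fun x ↦ by rwa [x.2], fun x y hxy ↦ absurd (Subsingleton.elim x y) hxy⟩
  obtain ⟨s, b, hs, hb⟩ := h_orthonormal.exists_orthonormalBasis_extension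
  exact ⟨s, b, ⟨e, hs rfl⟩, by rw [hb]⟩

variable [MeasurableSpace E] [BorelSpace E]

instance : (stdGaussian E).IsNegInvariant :=
  ⟨stdGaussian_map (LinearIsometryEquiv.neg ℝ)⟩

section OrthonormalBasis

variable {ι : Type*} [Fintype ι] (b : OrthonormalBasis ι ℝ E)

lemma hasLaw_inner_orthonormalBasis_stdGaussian :
    HasLaw (fun x i ↦ inner ℝ (b i) x) (Measure.pi fun _ ↦ gaussianReal 0 1) (stdGaussian E) := by
  refine ⟨by fun_prop, ?_⟩
  rw [stdGaussian_eq_map_pi_orthonormalBasis b, Measure.map_map (by fun_prop) (by fun_prop)]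
  convert Measure.map_id
  ext x i
  exact b.orthonormal.inner_right_fintype x i

lemma hasLaw_inner_orthonormalBasis_apply_stdGaussian (i : ι) :
    HasLaw (fun x ↦ inner ℝ (b i) x) (gaussianReal 0 1) (stdGaussian E) :=
  (measurePreserving_eval (fun _ ↦ gaussianReal 0 1) i).fun_comp_hasLaw
    (hasLaw_inner_orthonormalBasis_stdGaussian b)

lemma iIndepFun_inner_orthonormalBasis_stdGaussian :
    iIndepFun (fun i x ↦ inner ℝ (b i) x) (stdGaussian E) :=
  (iIndepFun_iff_hasLaw_pi_pi (hasLaw_inner_orthonormalBasis_apply_stdGaussian b)).2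
    (hasLaw_inner_orthonormalBasis_stdGaussian b)

end OrthonormalBasis

lemma ae_inner_ne_zero_stdGaussian {v : E} (hv : v ≠ 0) :
    ∀ᵐ x ∂stdGaussian E, inner ℝ x v ≠ 0 := by
  obtain ⟨s, b, i, hb⟩ := exists_orthonormalBasis_apply_eq (NormedSpace.norm_normalize hv)
  have := nullSingletonClass_gaussianReal (μ := 0) (one_ne_zero (α := ℝ≥0))
  have h_ae : ∀ᵐ x ∂stdGaussian E, inner ℝ (b i) x ≠ 0 :=
    ((hasLaw_inner_orthonormalBasis_apply_stdGaussian b i).ae_iff (by fun_prop)).2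
      (Measure.ae_ne _ 0)
  filter_upwards [h_ae] with x hx hxv
  rw [hb, NormedSpace.normalize, real_inner_smul_left, real_inner_comm, hxv] at hx
  simp at hx

lemma hasLaw_norm_sq_sin_angle_sq_orthonormalBasis (hE : 1 < finrank ℝ E) {ι : Type*} [Fintype ι]
    (b : OrthonormalBasis ι ℝ E) (i : ι) :
    HasLaw (fun x ↦ (‖x‖ ^ 2, Real.sin (angle x (b i)) ^ 2))
      ((gammaMeasure (finrank ℝ E / 2) (1 / 2)).prod
        (betaMeasure ((finrank ℝ E - 1) / 2) (1 / 2))) (stdGaussian E) := by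
  classical
  have h_card : ((Finset.univ.erase i).card : ℝ) = finrank ℝ E - 1 := by
    rw [Finset.card_erase_of_mem (Finset.mem_univ i), Finset.card_univ,
      ← finrank_eq_card_basis b.toBasis, Nat.cast_pred (by lia)]
  have h_nonempty : (Finset.univ.erase i).Nonempty := by
    rw [← Finset.card_pos, ← Nat.cast_pos (α := ℝ), h_card]
    exact sub_pos.2 (by exact_mod_cast hE)
  have h_law := hasLaw_sum_sq_div_of_iIndepFun_gaussianReal h_nonempty
    (Finset.singleton_nonempty i) (by simp) one_ne_zero
    (hasLaw_inner_orthonormalBasis_apply_stdGaussian b)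
    (iIndepFun_inner_orthonormalBasis_stdGaussian b)
  have h_norm (x : E) : ∑ j ∈ Finset.univ.erase i, inner ℝ (b j) x ^ 2 =
      ‖x‖ ^ 2 - inner ℝ (b i) x ^ 2 := by
    rw [← b.sum_sq_inner_right x, ← Finset.sum_erase_add _ _ (Finset.mem_univ i),
      add_sub_cancel_right]
  simp only [h_norm, h_card, Finset.sum_singleton, Finset.card_singleton, sub_add_cancel,
    NNReal.coe_one, mul_one, Nat.cast_one, ← add_div] at h_law
  -- The formula for the sine fails at `x = 0`, where `angle` takes the junk value `π / 2`.
  refine h_law.congr ?_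
  filter_upwards [ae_inner_ne_zero_stdGaussian (b.orthonormal.ne_zero i)] with x hx
  have hx₀ : x ≠ 0 := fun h ↦ hx (by rw [h, inner_zero_left])
  rw [sin_angle_sq_eq_div (b.norm_eq_one i) hx₀]

theorem hasLaw_norm_sq_sin_angle_sq_stdGaussian (hE : 1 < finrank ℝ E) {v : E} (hv : v ≠ 0) :
    HasLaw (fun x ↦ (‖x‖ ^ 2, Real.sin (angle x v) ^ 2))
      ((gammaMeasure (finrank ℝ E / 2) (1 / 2)).prod
        (betaMeasure ((finrank ℝ E - 1) / 2) (1 / 2))) (stdGaussian E) := by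
  obtain ⟨s, b, i, hb⟩ := exists_orthonormalBasis_apply_eq (NormedSpace.norm_normalize hv)
  simpa only [hb, angle_normalize_right] using hasLaw_norm_sq_sin_angle_sq_orthonormalBasis hE b i

end StdGaussian

section Sector

lemma measure_union_neg_of_aedisjoint {G : Type*} [MeasurableSpace G] [InvolutiveNeg G]
    [MeasurableNeg G] {μ : Measure G} [μ.IsNegInvariant] {s : Set G} (hs : MeasurableSet s)
    (hd : AEDisjoint μ s (-s)) : μ (s ∪ -s) = 2 * μ s := by
  rw [measure_union₀ hs.neg.nullMeasurableSet hd, Measure.measure_neg, two_mul]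

lemma sin_sq_le_sin_sq_iff {α θ : ℝ} (hα : α ∈ Icc 0 Real.pi) (hθ : θ ∈ Icc 0 (Real.pi / 2)) :
    Real.sin α ^ 2 ≤ Real.sin θ ^ 2 ↔ α ≤ θ ∨ Real.pi - α ≤ θ := by
  have h_pi := Real.pi_pos
  have h_mem : ∀ {β}, β ∈ Icc 0 (Real.pi / 2) → β ∈ Icc (-(Real.pi / 2)) (Real.pi / 2) :=
    fun hβ ↦ ⟨by linarith [hβ.1], hβ.2⟩
  rw [sq_le_sq₀ (Real.sin_nonneg_of_mem_Icc hα)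
    (Real.sin_nonneg_of_nonneg_of_le_pi hθ.1 (by linarith [hθ.2]))]
  rcases le_total α (Real.pi / 2) with h | h
  · rw [Real.strictMonoOn_sin.le_iff_le (h_mem ⟨hα.1, h⟩) (h_mem hθ)]
    exact ⟨Or.inl, fun h' ↦ h'.elim id fun h' ↦ by linarith [hθ.2]⟩
  · rw [← Real.sin_pi_sub, Real.strictMonoOn_sin.le_iff_le
      (h_mem ⟨by linarith [hα.2], by linarith⟩) (h_mem hθ)]
    exact ⟨Or.inr, fun h' ↦ h'.elim (fun h' ↦ by linarith [hθ.2]) id⟩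

variable {d : ℕ} {v : EuclideanSpace ℝ (Fin d)} {R₁ R₂ θ : ℝ}

lemma mem_sectorShell_zero_iff {x : EuclideanSpace ℝ (Fin d)} (hR₁ : 0 ≤ R₁) (hR : R₁ ≤ R₂)
    (hv : v ≠ 0) (hθ : θ ∈ Icc 0 Real.pi) :
    x ∈ sectorShell 0 R₂ R₁ v θ ↔ ‖x‖ ^ 2 ∈ Ioc (R₁ ^ 2) (R₂ ^ 2) ∧ angle x v ≤ θ := by
  rw [mem_Ioc, sq_lt_sq₀ hR₁ (norm_nonneg x), sq_le_sq₀ (norm_nonneg x) (hR₁.trans hR),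
    sectorShell, mem_sdiff]
  rcases eq_or_ne x 0 with rfl | hx
  · simp [sector, hR₁, hR₁.not_gt]
  · rw [mem_sector_iff_angle hv hx hθ.1 hθ.2, mem_sector_iff_angle hv hx hθ.1 hθ.2, sub_zero,
      mem_closedBall_zero_iff, mem_closedBall_zero_iff]
    grind

lemma isClosed_sector (c : EuclideanSpace ℝ (Fin d)) (R : ℝ) : IsClosed (sector c R v θ) := by
  have h_cone : IsClosed {x | ‖x - c‖ * ‖v‖ * Real.cos θ ≤ inner ℝ (x - c) v} :=
    isClosed_le (by fun_prop) (by fun_prop)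
  exact Metric.isClosed_closedBall.inter h_cone

lemma measurableSet_sectorShell (c : EuclideanSpace ℝ (Fin d)) :
    MeasurableSet (sectorShell c R₂ R₁ v θ) :=
  (isClosed_sector c R₂).measurableSet.diff (isClosed_sector c R₁).measurableSet

lemma sectorShell_union_neg (hR₁ : 0 ≤ R₁) (hR : R₁ ≤ R₂) (hv : v ≠ 0)
    (hθ : θ ∈ Icc 0 (Real.pi / 2)) :
    sectorShell 0 R₂ R₁ v θ ∪ -sectorShell 0 R₂ R₁ v θ =
      (fun x ↦ (‖x‖ ^ 2, Real.sin (angle x v) ^ 2)) ⁻¹'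
        (Ioc (R₁ ^ 2) (R₂ ^ 2) ×ˢ Iic (Real.sin θ ^ 2)) := by
  have hθ' : θ ∈ Icc 0 Real.pi := ⟨hθ.1, by linarith [hθ.2, Real.pi_pos]⟩
  ext x
  rw [mem_union, mem_neg, mem_sectorShell_zero_iff hR₁ hR hv hθ',
    mem_sectorShell_zero_iff hR₁ hR hv hθ', norm_neg, angle_neg_left, ← and_or_left,
    mem_preimage, mem_prod, mem_Iic, sin_sq_le_sin_sq_iff ⟨angle_nonneg _ _, angle_le_pi _ _⟩ hθ]

lemma aedisjoint_sectorShell_neg (hR₁ : 0 ≤ R₁) (hR : R₁ ≤ R₂) (hv : v ≠ 0)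
    (hθ : θ ∈ Icc 0 (Real.pi / 2)) :
    AEDisjoint (stdGaussian (EuclideanSpace ℝ (Fin d)))
      (sectorShell 0 R₂ R₁ v θ) (-sectorShell 0 R₂ R₁ v θ) := by
  have hθ' : θ ∈ Icc 0 Real.pi := ⟨hθ.1, by linarith [hθ.2, Real.pi_pos]⟩
  refine measure_mono_null (fun x hx ↦ ?_) (ae_iff.1 (ae_inner_ne_zero_stdGaussian hv))
  have h_pos := ((mem_sectorShell_zero_iff hR₁ hR hv hθ').1 hx.1).2
  have h_neg := ((mem_sectorShell_zero_iff hR₁ hR hv hθ').1 hx.2).2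
  rw [angle_neg_left] at h_neg
  rw [mem_ofPred_eq, not_not, inner_eq_zero_iff_angle_eq_pi_div_two]
  linarith [hθ.2]

theorem stdGaussian_real_sectorShell (hd : 2 ≤ d) (hR₁ : 0 ≤ R₁) (hR : R₁ ≤ R₂) (hv : v ≠ 0)
    (hθ : θ ∈ Icc 0 (Real.pi / 2)) :
    (stdGaussian (EuclideanSpace ℝ (Fin d))).real (sectorShell 0 R₂ R₁ v θ) =
      (gammaMeasure (d / 2) (1 / 2)).real (Ioc (R₁ ^ 2) (R₂ ^ 2)) *
        (betaMeasure ((d - 1) / 2) (1 / 2)).real (Iic (Real.sin θ ^ 2)) / 2 := by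
  have h_law := hasLaw_norm_sq_sin_angle_sq_stdGaussian (by rwa [finrank_euclideanSpace_fin]) hv
  rw [finrank_euclideanSpace_fin] at h_law
  have := isProbabilityMeasureBeta (half_pos (sub_pos.2 (by exact_mod_cast hd : (1 : ℝ) < d)))
    one_half_pos
  have h_double := measure_union_neg_of_aedisjoint (measurableSet_sectorShell 0)
    (aedisjoint_sectorShell_neg hR₁ hR hv hθ)
  rw [sectorShell_union_neg hR₁ hR hv hθ,
    ← Measure.map_apply_of_aemeasurable h_law.aemeasurable
      (measurableSet_Ioc.prod measurableSet_Iic), h_law.map_eq] at h_double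
  rw [← measureReal_prod_prod, measureReal_def, measureReal_def, h_double, ENNReal.toReal_mul,
    ENNReal.toReal_ofNat, mul_div_cancel_left₀ _ two_ne_zero]

lemma gammaMeasure_real_Ioc_eq_deltaPsi (hd : 0 < d) (hR₁ : 0 ≤ R₁) (hR : R₁ ≤ R₂) :
    (gammaMeasure (d / 2) (1 / 2)).real (Ioc (R₁ ^ 2) (R₂ ^ 2)) = deltaPsi d R₁ R₂ := by
  have := isProbabilityMeasure_gammaMeasure (a := (d : ℝ) / 2) (r := 1 / 2) (by positivity)
    one_half_pos
  rw [deltaPsi, Psi, Psi, if_pos hR₁, if_pos (hR₁.trans hR), chiSqCDF, chiSqCDF, cdf_eq_real,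
    cdf_eq_real, ← Iic_sdiff_Iic, measureReal_sdiff (Iic_subset_Iic.2 (by gcongr))
      measurableSet_Iic, sub_sub_sub_cancel_left]

lemma betaMeasure_real_Iic_eq_regIncBeta {a b x : ℝ} (ha : 0 < a) (hb : 0 < b) (hx₀ : 0 ≤ x)
    (hx₁ : x ≤ 1) :
    (betaMeasure a b).real (Iic x) = regIncBeta x a b := by
  have h_beta := beta_pos ha hb
  rw [measureReal_def, betaMeasure, withDensity_apply _ measurableSet_Iic, regIncBeta,
    ← intervalIntegral.integral_const_mul, intervalIntegral.integral_of_le hx₀,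
    integral_Ioc_eq_integral_Ioo, integral_eq_lintegral_of_nonneg_ae]
  · congr 1
    rw [← Iic_union_Ioc_eq_Iic hx₀, lintegral_union measurableSet_Ioc
      (Iic_disjoint_Ioc le_rfl), setLIntegral_congr_fun (g := fun _ ↦ 0) measurableSet_Iic
      (fun t ht ↦ betaPDF_eq_zero_of_nonpos ht), lintegral_zero, zero_add,
      setLIntegral_congr Ioo_ae_eq_Ioc.symm]
    refine setLIntegral_congr_fun measurableSet_Ioo fun t ht ↦ ?_
    rw [betaPDF_of_pos_lt_one ht.1 (ht.2.trans_le hx₁), mul_assoc]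
  · refine ae_restrict_of_forall_mem measurableSet_Ioo fun t ht ↦ ?_
    have : 0 < t := ht.1
    have : 0 < 1 - t := by linarith [ht.2]
    simp only [Pi.zero_apply]
    positivity
  · exact Measurable.aestronglyMeasurable (by fun_prop)

end Sector

end SphericalSector

theorem mainTheorem2 {Ω : Type*} [MeasurableSpace Ω] (P : Measure Ω) [IsProbabilityMeasure P]
    (d : ℕ) (hd : 2 ≤ d) (z : Ω → EuclideanSpace ℝ (Fin d))
    (hz : HasLaw z (multivariateGaussian 0 (1 : Matrix (Fin d) (Fin d) ℝ)) P)
    (R₁ R₂ : ℝ) (hR₁ : 0 ≤ R₁) (hR : R₁ ≤ R₂)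
    (v : EuclideanSpace ℝ (Fin d)) (hv : v ≠ 0)
    (θ : ℝ) (hθ : θ ∈ Set.Icc 0 (Real.pi / 2)) :
    P.real {ω | z ω ∈ SphericalSector.sectorShell 0 R₂ R₁ v θ} =
      SphericalSector.sectorI d (Real.cos θ) / 2 * SphericalSector.deltaPsi d R₁ R₂ := by
  have hd' : (0 : ℝ) < (d - 1) / 2 := half_pos (sub_pos.2 (by exact_mod_cast hd))
  rw [multivariateGaussian_zero_one] at hz
  calc P.real {ω | z ω ∈ SphericalSector.sectorShell 0 R₂ R₁ v θ}
      = (stdGaussian (EuclideanSpace ℝ (Fin d))).real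
          (SphericalSector.sectorShell 0 R₂ R₁ v θ) :=
        hz.measureReal_eq (SphericalSector.measurableSet_sectorShell 0)
    _ = (gammaMeasure (d / 2) (1 / 2)).real (Set.Ioc (R₁ ^ 2) (R₂ ^ 2)) *
          (betaMeasure ((d - 1) / 2) (1 / 2)).real (Set.Iic (Real.sin θ ^ 2)) / 2 :=
        SphericalSector.stdGaussian_real_sectorShell hd hR₁ hR hv hθ
    _ = SphericalSector.deltaPsi d R₁ R₂ * SphericalSector.sectorI d (Real.cos θ) / 2 := by
        rw [SphericalSector.gammaMeasure_real_Ioc_eq_deltaPsi (by lia) hR₁ hR,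
          SphericalSector.betaMeasure_real_Iic_eq_regIncBeta hd' one_half_pos (sq_nonneg _)
            (Real.sin_sq_le_one θ), Real.sin_sq, SphericalSector.sectorI]
    _ = SphericalSector.sectorI d (Real.cos θ) / 2 * SphericalSector.deltaPsi d R₁ R₂ := by ring
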